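/- All languages are relational, and a structure in a language containing the binary symbol $<$ is called ordered if $<$ is interpreted as a strict linear order. The age of a structure $A$ is the class of all finite structures that embed in $A$. A class $\mathcal K$ of finite structures has the Ramsey property (RP) if for all $A,B\in\mathcal K$ and every integer $k\ge 1$ there is $C\in\mathcal K$ such that for every map $c:\binom{C}{A}\to\{1,\dots,k\}$ there is $B'\in\binom{C}{B}$ such that $c$ is constant on $\binom{B'}{A}$; here $\binom{Y}{X}$ is the set of substructures of $Y$ isomorphic to $X$. A structure has RP if its age has RP. Let $L_1,L_2$ be relational languages with $L_1\cap L_2=\{<\}$. Let $\mathcal I$ be a countable ordered $L_2$-structure with underlying set $I$, and for each $i\in I$ let $M_i$ be a countable ordered $L_1$-structure. Assume that there is a class $\mathcal K$ such that $\mathrm{age}(M_i)=\mathcal K$ for all $i\in I$. Let $\mathbb I=\mathcal I_{i\in I}(M_i)$ be the structure in the language $L_1\cup L_2\cup\{E\}$, where $E$ is a new binary relation symbol, whose domain is the disjoint union $\bigsqcup_{i\in I}M_i$ and whose relations are as follows. - $E^{\mathbb I}$ is the equivalence relation whose classes are the sets $M_i$. - For $a\in M_i$ and $b\in M_j$: $a<^{\mathbb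 I}b$ if and only if $i<^{\mathcal I}j$, or $i=j$ and $a<^{M_i}b$. - For $R\in L_1\setminus\{<\}$ of arity $n$: $R^{\mathbb I}(a_0,\dots,a_{n-1})$ if and only if there is $i\in I$ such that $a_0,\dots,a_{n-1}\in M_i$ and $M_i\models R(a_0,\dots,a_{n-1})$. - For $R\in L_2\setminus\{<\}$ of arity $n$ and $a_j\in M_{t_j}$ ($j<n$): $R^{\mathbb I}(a_0,\dots,a_{n-1})$ if and only if $\mathcal I\models R(t_0,\dots,t_{n-1})$. If $\mathcal I$ has RP and $\mathcal K$ has RP, then $\mathbb I$ has RP. -/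

import Mathlib

open scoped FirstOrder

universe u₁ u₂ v w

/-- The symbols of the relational language `{<} ∪ σ`; `σ n` is the set of `n`-ary
relation symbols other than `<`. -/
inductive OrdRel (σ : ℕ → Type v) : ℕ → Type v
  | lt : OrdRel σ 2
  | rel {n : ℕ} (R : σ n) : OrdRel σ n

/-- The relational language `{<} ∪ σ`. -/
def ordLanguage (σ : ℕ → Type v) : FirstOrder.Language.{0, v} where
  Functions := fun _ => Empty
  Relations := OrdRel σ

/-- `M` is an ordered structure: the symbol `<` is interpreted as a strict linear order. -/
def IsOrderedStructure (σ : ℕ → Type v) (M : Type w) [(ordLanguage σ).Structure M] : Prop :=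
  IsStrictTotalOrder M fun a b =>
    FirstOrder.Language.Structure.RelMap (L := ordLanguage σ) (OrdRel.lt : OrdRel σ 2) ![a, b]

/-- The set of copies of `A` in `C`: the substructures of `C` isomorphic to `A`. -/
def copies (L : FirstOrder.Language.{u₁, v}) (C A : Type w) [L.Structure C] [L.Structure A] :
    Set (L.Substructure C) :=
  {S | Nonempty (S ≃[L] A)}

/-- The Ramsey property of a class of structures. -/
def RamseyProperty {L : FirstOrder.Language.{u₁, v}} (K : Set (CategoryTheory.Bundled.{w} L.Structure)) :
    Prop :=
  ∀ A ∈ K, ∀ B ∈ K, ∀ k : ℕ, 1 ≤ k → ∃ C ∈ K, ∀ c : copies L C A → Fin k,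
    ∃ B' ∈ copies L C B, ∀ A' A'' : copies L C A,
      (A' : L.Substructure C) ≤ B' → (A'' : L.Substructure C) ≤ B' → c A' = c A''

/-- A structure has the Ramsey property if its age does. -/
def HasRP (L : FirstOrder.Language.{u₁, v}) (M : Type w) [L.Structure M] : Prop :=
  RamseyProperty (L.age M)

/-- The symbols of `L₁ ∪ L₂ ∪ {E}`, where `L₁ = {<} ∪ σ₁`, `L₂ = {<} ∪ σ₂` and
`L₁ ∩ L₂ = {<}`. -/
inductive SemidirectRel (σ₁ : ℕ → Type u₁) (σ₂ : ℕ → Type u₂) : ℕ → Type (max u₁ u₂)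
  | lt : SemidirectRel σ₁ σ₂ 2
  | E : SemidirectRel σ₁ σ₂ 2
  | fiber {n : ℕ} (R : σ₁ n) : SemidirectRel σ₁ σ₂ n
  | base {n : ℕ} (R : σ₂ n) : SemidirectRel σ₁ σ₂ n

/-- The relational language `L₁ ∪ L₂ ∪ {E}`. -/
def semidirectLanguage (σ₁ : ℕ → Type u₁) (σ₂ : ℕ → Type u₂) :
    FirstOrder.Language.{0, max u₁ u₂} where
  Functions := fun _ => Empty
  Relations := SemidirectRel σ₁ σ₂

/-- The domain of the semi-direct product structure: the disjoint union of the `M i`. -/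
def SemidirectUnion (I : Type v) (M : I → Type w) : Type (max v w) := Σ i, M i

/-- The semi-direct product structure on the disjoint union of the `M i`. -/
instance semidirectStructure (σ₁ : ℕ → Type u₁) (σ₂ : ℕ → Type u₂)
    (I : Type v) [(ordLanguage σ₂).Structure I]
    (M : I → Type w) [∀ i, (ordLanguage σ₁).Structure (M i)] :
    (semidirectLanguage σ₁ σ₂).Structure (SemidirectUnion I M) where
  funMap := fun f _ => nomatch f
  RelMap := fun {_} r => match r with
    | SemidirectRel.lt => fun x : Fin 2 → Σ i, M i =>
        FirstOrder.Language.Structure.RelMap (L := ordLanguage σ₂) (OrdRel.lt : OrdRel σ₂ 2)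
            ![(x 0).1, (x 1).1] ∨
          ∃ (i : I) (a b : M i), x 0 = ⟨i, a⟩ ∧ x 1 = ⟨i, b⟩ ∧
            FirstOrder.Language.Structure.RelMap (L := ordLanguage σ₁) (OrdRel.lt : OrdRel σ₁ 2) ![a, b]
    | SemidirectRel.E => fun x : Fin 2 → Σ i, M i => (x 0).1 = (x 1).1
    | SemidirectRel.fiber (n := n) R => fun x : Fin n → Σ i, M i =>
        ∃ (i : I) (a : Fin n → M i), (∀ j, x j = ⟨i, a j⟩) ∧
          FirstOrder.Language.Structure.RelMap (L := ordLanguage σ₁) (OrdRel.rel R : OrdRel σ₁ n) a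
    | SemidirectRel.base (n := n) R => fun x : Fin n → Σ i, M i =>
        FirstOrder.Language.Structure.RelMap (L := ordLanguage σ₂) (OrdRel.rel R : OrdRel σ₂ n)
          fun j => (x j).1

/-!
An embedding of one semi-direct product with nonempty fibers into another is the same thing as an
embedding `h` of the bases together with an embedding `d i` of the `i`-th fiber for every `i`. To
colour such pairs, first choose a base `C₀` by the Ramsey property of the bases alone. As all
fibers have age `K`, the fibers involved embed in one member of `K`; the product Ramsey theorem in
a finite power of `K`, applied for each of the finitely many `h`, gives fibers over `C₀` along
which the colour of `(h, d)` depends on `h` only, and the choice of `C₀` then makes it constant.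

A fiber may have automorphisms, so colourings of copies are replaced by colourings of embeddings
that are invariant under automorphisms of the domain. The base is finite and linearly ordered,
hence rigid, so that every colouring of its embeddings is invariant.
-/

section RamseyCategory

open CategoryTheory

variable {𝒞 𝒟 : Type*} [Category 𝒞] [Category 𝒟] {κ : Type*}

/-- A colouring of the morphisms `A ⟶ D` which is invariant under the endomorphisms of `A`.
For embeddings of a finite structure `A`, whose endomorphisms are its automorphisms, these are the
colourings of the copies of `A`. -/
def EndInvariant {A D : 𝒞} (c : (A ⟶ D) → κ) : Prop :=
  ∀ (e : A ⟶ A) (f : A ⟶ D), c (e ≫ f) = c f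

/-- The partition relation `D → (B)^A_κ` in a category. -/
def RamseyArrow (A B D : 𝒞) (κ : Type*) : Prop :=
  ∀ c : (A ⟶ D) → κ, EndInvariant c → ∃ g : B ⟶ D, ∀ u u' : A ⟶ B, c (u ≫ g) = c (u' ≫ g)

/-- The Ramsey property of a category; `k + 1` is the number of colours. -/
def IsRamsey (𝒞 : Type*) [Category 𝒞] : Prop :=
  ∀ (A B : 𝒞) (k : ℕ), ∃ D : 𝒞, RamseyArrow A B D (Fin (k + 1))

theorem EndInvariant.comp_right {A B D : 𝒞} {c : (A ⟶ D) → κ} (hc : EndInvariant c)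
    (g : B ⟶ D) : EndInvariant fun f : A ⟶ B => c (f ≫ g) := fun e f => by
  simpa only [Category.assoc] using hc e (f ≫ g)

theorem RamseyArrow.of_subsingleton (A B : 𝒞) [Subsingleton (A ⟶ B)] (κ : Type*) :
    RamseyArrow A B B κ :=
  fun c _ => ⟨𝟙 B, fun u u' => congrArg (fun v => c (v ≫ 𝟙 B)) (Subsingleton.elim u u')⟩

theorem RamseyArrow.of_iso {A A' B B' D : 𝒞} (h : RamseyArrow A' B' D κ) (a : A ≅ A')
    (b : B ≅ B') : RamseyArrow A B D κ := fun c hc => by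
  obtain ⟨g, hg⟩ := h (fun f => c (a.hom ≫ f)) fun e f => by
    simpa using hc (a.hom ≫ e ≫ a.inv) (a.hom ≫ f)
  exact ⟨b.hom ≫ g, fun u u' => by simpa using hg (a.inv ≫ u ≫ b.hom) (a.inv ≫ u' ≫ b.hom)⟩

theorem IsRamsey.exists_arrow_of_finite (h𝒞 : IsRamsey 𝒞) (A B : 𝒞) (κ : Type*) [Finite κ] :
    ∃ D : 𝒞, RamseyArrow A B D κ := by
  obtain ⟨n, ⟨e⟩⟩ := Finite.exists_equiv_fin κ
  obtain ⟨D, hD⟩ := h𝒞 A B n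
  refine ⟨D, fun c hc => ?_⟩
  obtain ⟨g, hg⟩ := hD (fun u => (e (c u)).castSucc) fun u f =>
    congrArg (fun a => (e a).castSucc) (hc u f)
  exact ⟨g, fun u u' => e.injective (Fin.castSucc_injective n (hg u u'))⟩

theorem IsRamsey.exists_forall_arrow (h𝒞 : IsRamsey 𝒞) {T : Type*} [Finite T] (A : T → 𝒞)
    (B : 𝒞) (κ : Type*) [Finite κ] :
    ∃ D : 𝒞, ∀ c : ∀ t, (A t ⟶ D) → κ, (∀ t, EndInvariant (c t)) →
      ∃ g : B ⟶ D, ∀ t, ∀ u u' : A t ⟶ B, c t (u ≫ g) = c t (u' ≫ g) := by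
  classical
  suffices H : ∀ s : Finset T, ∃ D : 𝒞, ∀ c : ∀ t, (A t ⟶ D) → κ, (∀ t, EndInvariant (c t)) →
      ∃ g : B ⟶ D, ∀ t ∈ s, ∀ u u' : A t ⟶ B, c t (u ≫ g) = c t (u' ≫ g) by
    cases nonempty_fintype T
    simpa only [Finset.mem_univ, true_imp_iff] using H Finset.univ
  intro s
  induction s using Finset.induction_on with
  | empty => exact ⟨B, fun _ _ => ⟨𝟙 B, fun t ht => absurd ht (Finset.notMem_empty t)⟩⟩
  | insert t s _ ih =>
    obtain ⟨D', hD'⟩ := ih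
    obtain ⟨D, hD⟩ := h𝒞.exists_arrow_of_finite (A t) D' κ
    refine ⟨D, fun c hc => ?_⟩
    obtain ⟨g₁, hg₁⟩ := hD (c t) (hc t)
    obtain ⟨g₂, hg₂⟩ := hD' (fun q v => c q (v ≫ g₁)) fun q => (hc q).comp_right g₁
    refine ⟨g₂ ≫ g₁, fun q hq u u' => ?_⟩
    simp only [← Category.assoc]
    rcases Finset.mem_insert.1 hq with rfl | hq
    · exact hg₁ (u ≫ g₂) (u' ≫ g₂)
    · exact hg₂ q hq u u'

theorem IsRamsey.of_adjunction (h𝒞 : IsRamsey 𝒞) {G : 𝒟 ⥤ 𝒞} {F : 𝒞 ⥤ 𝒟} (adj : G ⊣ F)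
    [G.Full] : IsRamsey 𝒟 := by
  intro A B k
  obtain ⟨D, hD⟩ := h𝒞 (G.obj A) (G.obj B) k
  refine ⟨F.obj D, fun c hc => ?_⟩
  obtain ⟨g, hg⟩ := hD (fun f => c (adj.homEquiv A D f)) fun e f => by
    obtain ⟨e, rfl⟩ := G.map_surjective e
    exact (congrArg c (adj.homEquiv_naturality_left e f)).trans (hc _ _)
  refine ⟨adj.homEquiv B D g, fun u u' => ?_⟩
  simp only [← adj.homEquiv_naturality_left]
  exact hg _ _

theorem IsRamsey.prod (h𝒞 : IsRamsey 𝒞) (h𝒟 : IsRamsey 𝒟) [∀ X Y : 𝒞, Finite (X ⟶ Y)] :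
    IsRamsey (𝒞 × 𝒟) := by
  intro A B k
  obtain hAB | ⟨⟨ι⟩⟩ := isEmpty_or_nonempty (A.2 ⟶ B.2)
  · have : IsEmpty (A ⟶ B) := ⟨fun u => hAB.false u.2⟩
    exact ⟨B, .of_subsingleton A B _⟩
  obtain ⟨D₁, hD₁⟩ := h𝒞 A.1 B.1 k
  obtain ⟨D₂, hD₂⟩ := h𝒟.exists_arrow_of_finite A.2 B.2 ((A.1 ⟶ D₁) → Fin (k + 1))
  refine ⟨(D₁, D₂), fun c hc => ?_⟩
  have hc₁ (f₂ : A.2 ⟶ D₂) : EndInvariant fun f₁ => c (Prod.mkHom f₁ f₂) := fun e f₁ => by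
    simpa using hc (Prod.mkHom e (𝟙 A.2)) (Prod.mkHom f₁ f₂)
  have hc₂ : EndInvariant fun f₂ f₁ => c (Prod.mkHom f₁ f₂) := fun e f₂ => funext fun f₁ => by
    simpa using hc (Prod.mkHom (𝟙 A.1) e) (Prod.mkHom f₁ f₂)
  obtain ⟨g₂, hg₂⟩ := hD₂ _ hc₂
  obtain ⟨g₁, hg₁⟩ := hD₁ _ (hc₁ (ι ≫ g₂))
  have h_fst (u : A ⟶ B) :
      c (u ≫ Prod.mkHom g₁ g₂) = c (Prod.mkHom (u.1 ≫ g₁) (ι ≫ g₂)) :=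
    congrFun (hg₂ u.2 ι) (u.1 ≫ g₁)
  exact ⟨Prod.mkHom g₁ g₂, fun u u' => by rw [h_fst u, h_fst u', hg₁ u.1 u'.1]⟩

theorem IsRamsey.pi {X : Type*} [Finite X] {𝒞 : X → Type*} [∀ x, Category (𝒞 x)]
    [∀ x, ∀ Y Z : 𝒞 x, Finite (Y ⟶ Z)] (h𝒞 : ∀ x, IsRamsey (𝒞 x)) : IsRamsey (∀ x, 𝒞 x) := by
  induction X using Finite.induction_empty_option with
  | of_equiv e ih =>
    exact (ih fun x => h𝒞 (e x)).of_adjunction (Pi.equivalenceOfEquiv 𝒞 e).symm.toAdjunction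
  | h_empty =>
    intro A B k
    have : Subsingleton (A ⟶ B) := inferInstanceAs (Subsingleton (∀ x, A x ⟶ B x))
    exact ⟨B, .of_subsingleton A B _⟩
  | h_option ih =>
    exact ((h𝒞 none).prod (ih fun x => h𝒞 (some x))).of_adjunction
      (Pi.optionEquivalence 𝒞).toAdjunction

theorem IsRamsey.exists_forall_arrow_of_injective {X P T : Type*} [Finite X] [Finite T]
    [Nonempty P] (h𝒞 : IsRamsey 𝒞) [∀ Y Z : 𝒞, Finite (Y ⟶ Z)] (h : T → P → X)
    (h_inj : ∀ t, Function.Injective (h t)) (A : P → 𝒞) (B : 𝒞) (κ : Type*) [Finite κ] :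
    ∃ D : X → 𝒞, ∀ c : ∀ t, (A ⟶ fun p => D (h t p)) → κ, (∀ t, EndInvariant (c t)) →
      ∃ g : ∀ x, B ⟶ D x, ∀ t, ∀ u u' : ∀ p, A p ⟶ B,
        c t (fun p => u p ≫ g (h t p)) = c t (fun p => u' p ≫ g (h t p)) := by
  -- A colouring of tuples indexed by `P` is read, through `h t`, as one of tuples indexed by `X`:
  -- `A` is spread over `X` along a retraction of `h t`, and the coordinates outside the range of
  -- `h t` are ignored.
  let r (t : T) : X → P := Function.invFun (h t)
  have hr (t : T) (p : P) : p = r t (h t p) := (Function.leftInverse_invFun (h_inj t) p).symm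
  let res (t : T) {D : X → 𝒞} (f : (fun x => A (r t x)) ⟶ D) : A ⟶ fun p => D (h t p) :=
    fun p => eqToHom (congrArg A (hr t p)) ≫ f (h t p)
  obtain ⟨D, hD⟩ := (IsRamsey.pi fun _ : X => h𝒞).exists_forall_arrow
    (fun t x => A (r t x)) (fun _ => B) κ
  refine ⟨D, fun c hc => ?_⟩
  obtain ⟨g, hg⟩ := hD (fun t f => c t (res t f)) fun t e f => by
    have res_comp : res t (e ≫ f) = (fun p =>
        eqToHom (congrArg A (hr t p)) ≫ e (h t p) ≫ eqToHom (congrArg A (hr t p)).symm) ≫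
          res t f := funext fun p => by simp [res]
    exact (congrArg (c t) res_comp).trans (hc t _ _)
  refine ⟨g, fun t u u' => ?_⟩
  have res_comp (u : ∀ p, A p ⟶ B) :
      res t (fun x => u (r t x) ≫ g x) = fun p => u p ≫ g (h t p) := funext fun p => by
    simp only [res, ← Category.assoc, ← eqToHom_naturality (g := fun _ => B) u (hr t p)]
    simp
  rw [← res_comp, ← res_comp]
  exact hg t (fun x => u (r t x)) fun x => u' (r t x)

end RamseyCategory

section Copies

open FirstOrder FirstOrder.Language CategoryTheory

variable {L : FirstOrder.Language.{u₁, v}}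

/-- A class of structures as a category whose morphisms are the embeddings. -/
instance embeddingCategory (K : Set (Bundled.{w} L.Structure)) : Category K where
  Hom X Y := X.1 ↪[L] Y.1
  id X := Embedding.refl L X.1
  comp f g := g.comp f

section

variable {A B C : Type w} [L.Structure A] [L.Structure B] [L.Structure C]

/-- The range of an embedding, as a copy of its domain. -/
def copyOf (f : A ↪[L] C) : copies L C A :=
  ⟨f.toHom.range, ⟨f.equivRange.symm⟩⟩

theorem copyOf_surjective : Function.Surjective (copyOf : (A ↪[L] C) → copies L C A) := by
  rintro ⟨S, ⟨φ⟩⟩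
  refine ⟨S.subtype.comp φ.symm.toEmbedding, Subtype.ext (SetLike.ext fun y => ⟨?_, fun hy => ?_⟩)⟩
  · rintro ⟨x, rfl⟩
    exact (φ.symm x).2
  · exact ⟨φ ⟨y, hy⟩, congrArg Subtype.val (φ.symm_apply_apply ⟨y, hy⟩)⟩

theorem copyOf_le_copyOf_iff {f : A ↪[L] C} {g : B ↪[L] C} :
    (copyOf f : L.Substructure C) ≤ copyOf g ↔ ∃ u : A ↪[L] B, g.comp u = f := by
  constructor
  · intro h
    let u := g.equivRange.symm.toEmbedding.comp
      (f.codRestrict g.toHom.range fun x => h ⟨x, rfl⟩)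
    exact ⟨u, Embedding.ext fun x =>
      congrArg Subtype.val (g.equivRange.apply_symm_apply ⟨f x, h ⟨x, rfl⟩⟩)⟩
  · rintro ⟨u, rfl⟩ _ ⟨x, rfl⟩
    exact ⟨u x, rfl⟩

theorem copyOf_comp_self [Finite A] (f : A ↪[L] C) (e : A ↪[L] A) :
    copyOf (f.comp e) = copyOf f := by
  refine Subtype.ext (le_antisymm (copyOf_le_copyOf_iff.2 ⟨e, rfl⟩) ?_)
  rintro _ ⟨x, rfl⟩
  obtain ⟨y, rfl⟩ := Finite.surjective_of_injective e.injective x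
  exact ⟨y, rfl⟩

end

variable {K : Set (Bundled.{w} L.Structure)}

theorem EndInvariant.eq_of_copyOf_eq {A C : K} {κ : Type*} {c : (A ⟶ C) → κ}
    (hc : EndInvariant c) {f f' : A.1 ↪[L] C.1} (h : copyOf f = copyOf f') : c f = c f' := by
  obtain ⟨e, rfl⟩ := copyOf_le_copyOf_iff.1 (congrArg Subtype.val h).le
  exact hc e f'

theorem ramseyArrow_iff_copies {A B C : K} [Finite A.1] {κ : Type*} :
    RamseyArrow A B C κ ↔ ∀ c : copies L C.1 A.1 → κ,
      ∃ B' ∈ copies L C.1 B.1, ∀ A' A'' : copies L C.1 A.1,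
        (A' : L.Substructure C.1) ≤ B' → (A'' : L.Substructure C.1) ≤ B' → c A' = c A'' := by
  constructor
  · intro h c
    obtain ⟨g, hg⟩ := h (fun f => c (copyOf f)) fun e f => congrArg c (copyOf_comp_self f e)
    refine ⟨copyOf g, (copyOf g).2, fun A' A'' h' h'' => ?_⟩
    obtain ⟨f', rfl⟩ := copyOf_surjective A'
    obtain ⟨f'', rfl⟩ := copyOf_surjective A''
    obtain ⟨u', rfl⟩ := copyOf_le_copyOf_iff.1 h'
    obtain ⟨u'', rfl⟩ := copyOf_le_copyOf_iff.1 h''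
    exact hg u' u''
  · intro h c hc
    let emb : copies L C.1 A.1 → (A ⟶ C) := Function.surjInv copyOf_surjective
    have c_emb (f : A ⟶ C) : c (emb (copyOf f)) = c f :=
      hc.eq_of_copyOf_eq (Function.surjInv_eq copyOf_surjective (copyOf f))
    obtain ⟨B', hB', hcB'⟩ := h fun A' => c (emb A')
    obtain ⟨g, hg⟩ := copyOf_surjective (⟨B', hB'⟩ : copies L C.1 B.1)
    obtain rfl : (copyOf g : L.Substructure C.1) = B' := congrArg Subtype.val hg
    refine ⟨g, fun u u' => ?_⟩
    have h_eq := hcB' (copyOf (g.comp u)) (copyOf (g.comp u'))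
      (copyOf_le_copyOf_iff.2 ⟨u, rfl⟩) (copyOf_le_copyOf_iff.2 ⟨u', rfl⟩)
    exact (c_emb _).symm.trans (h_eq.trans (c_emb _))

theorem ramseyProperty_iff_isRamsey [∀ X : K, Finite X.1] : RamseyProperty K ↔ IsRamsey K := by
  constructor
  · rintro h ⟨A, hA⟩ ⟨B, hB⟩ k
    obtain ⟨C, hC, h⟩ := h A hA B hB (k + 1) k.succ_pos
    exact ⟨⟨C, hC⟩, ramseyArrow_iff_copies.2 h⟩
  · intro h A hA B hB k hk
    obtain ⟨k, rfl⟩ := Nat.exists_eq_add_of_le' hk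
    obtain ⟨C, h⟩ := h ⟨A, hA⟩ ⟨B, hB⟩ k
    exact ⟨C.1, C.2, ramseyArrow_iff_copies.1 h⟩

instance finite_embedding {M N : Type*} [L.Structure M] [L.Structure N] [Finite M] [Finite N] :
    Finite (M ↪[L] N) :=
  DFunLike.finite _

theorem IsRamsey.exists_forall_embedding_arrow {𝒞 : Type*} [Category 𝒞]
    [∀ X Y : 𝒞, Finite (X ⟶ Y)] (h𝒞 : IsRamsey 𝒞) (hK : IsRamsey K) [∀ X : K, Finite X.1]
    {A₀ B₀ : K} [Nonempty A₀.1] [Subsingleton (A₀ ⟶ A₀)] {A : A₀.1 → 𝒞} {B : B₀.1 → 𝒞} {D : 𝒞}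
    (α : ∀ i, A i ⟶ D) (β : ∀ j, B j ⟶ D) (k : ℕ) :
    ∃ (C₀ : K) (C : C₀.1 → 𝒞),
      ∀ c : ∀ h : A₀.1 ↪[L] C₀.1, (A ⟶ fun i => C (h i)) → Fin (k + 1),
        (∀ h, EndInvariant (c h)) →
        ∃ (g₀ : B₀.1 ↪[L] C₀.1) (g : ∀ j, B j ⟶ C (g₀ j)),
          ∀ (h h' : A₀.1 ↪[L] B₀.1) (d : ∀ i, A i ⟶ B (h i)) (d' : ∀ i, A i ⟶ B (h' i)),
            c (g₀.comp h) (fun i => d i ≫ g (h i)) = c (g₀.comp h') fun i => d' i ≫ g (h' i) := by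
  obtain ⟨C₀, hC₀⟩ := hK A₀ B₀ k
  obtain ⟨C, hC⟩ := h𝒞.exists_forall_arrow_of_injective (fun h : A₀.1 ↪[L] C₀.1 => h)
    (fun h => h.injective) A D (Fin (k + 1))
  refine ⟨C₀, C, fun c hc => ?_⟩
  obtain ⟨G, hG⟩ := hC c hc
  let c₀ (h : A₀ ⟶ C₀) : Fin (k + 1) := c h fun i => α i ≫ G (h.toFun i)
  have c₀_inv : EndInvariant c₀ := fun e f => by
    rw [Subsingleton.elim e (𝟙 A₀), Category.id_comp]
  obtain ⟨(g₀ : B₀.1 ↪[L] C₀.1), hg₀⟩ := hC₀ c₀ c₀_inv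
  refine ⟨g₀, fun j => β j ≫ G (g₀ j), fun h h' d d' => ?_⟩
  have eq_base (h : A₀.1 ↪[L] B₀.1) (d : ∀ i, A i ⟶ B (h i)) :
      c (g₀.comp h) (fun i => d i ≫ β (h i) ≫ G (g₀ (h i))) =
        c (g₀.comp h) fun i => α i ≫ G (g₀ (h i)) := by
    simpa only [Category.assoc] using! hG (g₀.comp h) (fun i => d i ≫ β (h i)) α
  exact (eq_base h d).trans ((hg₀ h h').trans (eq_base h' d').symm)

end Copies

section OrderedStructure

open FirstOrder FirstOrder.Language

variable {σ : ℕ → Type v} {M N : Type*} [(ordLanguage σ).Structure M]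
  [(ordLanguage σ).Structure N]

instance ordLanguage_isRelational (σ : ℕ → Type v) : (ordLanguage σ).IsRelational :=
  fun _ => inferInstanceAs (IsEmpty Empty)

/-- The relation interpreting `<`. -/
def ordLt (σ : ℕ → Type v) {M : Type*} [(ordLanguage σ).Structure M] (a b : M) : Prop :=
  Structure.RelMap (L := ordLanguage σ) (OrdRel.lt : OrdRel σ 2) ![a, b]

/-- The relation interpreting a symbol other than `<`. -/
def ordRel {n : ℕ} (R : σ n) (a : Fin n → M) : Prop :=
  Structure.RelMap (L := ordLanguage σ) (OrdRel.rel R : OrdRel σ n) a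

theorem ordLt_map (f : M ↪[ordLanguage σ] N) (a b : M) :
    ordLt σ (f a) (f b) ↔ ordLt σ a b := by
  have h := f.map_rel (OrdRel.lt : OrdRel σ 2) ![a, b]
  rwa [← FinVec.map_eq] at h

theorem ordRel_map (f : M ↪[ordLanguage σ] N) {n : ℕ} (R : σ n) (a : Fin n → M) :
    ordRel R (fun j => f (a j)) ↔ ordRel R a :=
  f.map_rel (OrdRel.rel R : OrdRel σ n) a

/-- An embedding of structures in the language `{<} ∪ σ`. -/
def ordEmbedding (f : M → N) (hf : Function.Injective f)
    (hlt : ∀ a b, ordLt σ (f a) (f b) ↔ ordLt σ a b)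
    (hrel : ∀ {n : ℕ} (R : σ n) (a : Fin n → M), ordRel R (fun j => f (a j)) ↔ ordRel R a) :
    M ↪[ordLanguage σ] N where
  toFun := f
  inj' := hf
  map_fun' := fun g => isEmptyElim g
  map_rel' := fun {n} r => match n, r with
    | _, OrdRel.lt => fun x => by
      obtain ⟨a, b, rfl⟩ : ∃ a b, x = ![a, b] := ⟨x 0, x 1, (FinVec.etaExpand_eq x).symm⟩
      rw [← FinVec.map_eq]
      exact hlt a b
    | _, OrdRel.rel R => hrel R

theorem IsOrderedStructure.not_ordLt_self (hM : IsOrderedStructure σ M) (a : M) : ¬ ordLt σ a a :=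
  have : IsStrictTotalOrder M (ordLt σ) := hM
  irrefl a

theorem IsOrderedStructure.of_embedding (hN : IsOrderedStructure σ N)
    (f : M ↪[ordLanguage σ] N) : IsOrderedStructure σ M :=
  have : IsStrictTotalOrder N (ordLt σ) := hN
  (RelEmbedding.mk (s := ordLt σ) f.toEmbedding fun {a b} => ordLt_map f a b).isStrictTotalOrder

theorem IsOrderedStructure.subsingleton_embedding [Finite M] (hM : IsOrderedStructure σ M) :
    Subsingleton (M ↪[ordLanguage σ] M) := by
  classical
  have : IsStrictTotalOrder M (ordLt σ) := hM
  let _ : LinearOrder M := linearOrderOfSTO (ordLt σ)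
  have eq_id (f : M ↪[ordLanguage σ] M) : ⇑f = id :=
    StrictMono.eq_id fun a b hab => (ordLt_map f a b).2 hab
  exact ⟨fun f g => DFunLike.coe_injective ((eq_id f).trans (eq_id g).symm)⟩

end OrderedStructure

section Semidirect

open FirstOrder FirstOrder.Language

variable {σ₁ : ℕ → Type u₁} {σ₂ : ℕ → Type u₂}

instance semidirectLanguage_isRelational (σ₁ : ℕ → Type u₁) (σ₂ : ℕ → Type u₂) :
    (semidirectLanguage σ₁ σ₂).IsRelational :=
  fun _ => inferInstanceAs (IsEmpty Empty)

/-- All members of a family of structures satisfy the same nullary relations. Each fiber is then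
a substructure of the semi-direct product, in which a nullary symbol holds as soon as it holds in
some fiber. -/
def NullaryAgree (σ : ℕ → Type u₁) {I : Type*} (M : I → Type*)
    [∀ i, (ordLanguage σ).Structure (M i)] : Prop :=
  ∀ (R : σ 0) (i j : I) (x : Fin 0 → M i) (y : Fin 0 → M j), ordRel R x ↔ ordRel R y

variable {I : Type*} {M : I → Type*} [∀ i, (ordLanguage σ₁).Structure (M i)]
  {I' : Type*} {M' : I' → Type*} [∀ i, (ordLanguage σ₁).Structure (M' i)]

theorem NullaryAgree.of_embedding (hM : NullaryAgree σ₁ M) {h : I' → I}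
    (d : ∀ i, M' i ↪[ordLanguage σ₁] M (h i)) : NullaryAgree σ₁ M' := fun R i j x y => by
  rw [← ordRel_map (d i), ← ordRel_map (d j)]
  exact hM R _ _ _ _

namespace SemidirectUnion

theorem exists_eq_mk {x : SemidirectUnion I M} {i : I} (hx : x.1 = i) :
    ∃ a : M i, x = ⟨i, a⟩ := by
  obtain ⟨_, a⟩ := x
  cases hx
  exact ⟨a, rfl⟩

theorem exists_eq_fun_mk [Nonempty I] {ι : Type*} {x : ι → SemidirectUnion I M}
    (hx : ∀ j k, (x j).1 = (x k).1) : ∃ (i : I) (a : ι → M i), x = fun j => ⟨i, a j⟩ := by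
  obtain ⟨i, hi⟩ : ∃ i, ∀ j, (x j).1 = i := by
    obtain hι | ⟨⟨j₀⟩⟩ := isEmpty_or_nonempty ι
    · exact ⟨Classical.arbitrary I, hι.elim⟩
    · exact ⟨(x j₀).1, fun j => hx j j₀⟩
  choose a ha using fun j => exists_eq_mk (hi j)
  exact ⟨i, a, funext ha⟩

/-- The relation interpreting a symbol of the language of the fibers in the semi-direct
product. -/
def fiberRel {n : ℕ} (R : σ₁ n) (x : Fin n → SemidirectUnion I M) : Prop :=
  ∃ (i : I) (a : Fin n → M i), (∀ j, x j = ⟨i, a j⟩) ∧ ordRel R a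

theorem fst_eq_of_fiberRel {n : ℕ} {R : σ₁ n} {x : Fin n → SemidirectUnion I M}
    (hx : fiberRel R x) (j k : Fin n) : (x j).1 = (x k).1 := by
  obtain ⟨i, a, ha, -⟩ := hx
  rw [ha j, ha k]

theorem fiberRel_mk_iff (hM : NullaryAgree σ₁ M) {n : ℕ} {R : σ₁ n} {i : I} {a : Fin n → M i} :
    fiberRel R (fun j => (⟨i, a j⟩ : SemidirectUnion I M)) ↔ ordRel R a := by
  refine ⟨?_, fun h => ⟨i, a, fun _ => rfl, h⟩⟩
  rintro ⟨i', a', ha, hR⟩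
  cases n with
  | zero => exact (hM R i i' a a').2 hR
  | succ n =>
    obtain rfl : i = i' := congrArg Sigma.fst (ha 0)
    obtain rfl : a = a' := funext fun j => eq_of_heq (Sigma.mk.inj (ha j)).2
    exact hR

theorem fiberRel_map [Nonempty I'] (hM : NullaryAgree σ₁ M) {h : I' → I}
    (h_inj : Function.Injective h) (d : ∀ i, M' i ↪[ordLanguage σ₁] M (h i)) {n : ℕ} (R : σ₁ n)
    (x : Fin n → SemidirectUnion I' M') :
    fiberRel R (fun j => (⟨h (x j).1, d _ (x j).2⟩ : SemidirectUnion I M)) ↔ fiberRel R x := by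
  by_cases hx : ∀ j k, (x j).1 = (x k).1
  · obtain ⟨i, a, rfl⟩ := exists_eq_fun_mk hx
    rw [fiberRel_mk_iff (hM.of_embedding d), fiberRel_mk_iff hM (a := fun j => d i (a j)),
      ordRel_map]
  · exact iff_of_false (fun hR => hx fun j k => h_inj (fst_eq_of_fiberRel hR j k))
      fun hR => hx (fst_eq_of_fiberRel hR)

variable [(ordLanguage σ₂).Structure I] [(ordLanguage σ₂).Structure I']

/-- The relation interpreting `<` in the semi-direct product. -/
def lt (σ₁ : ℕ → Type u₁) (σ₂ : ℕ → Type u₂) {I : Type*} [(ordLanguage σ₂).Structure I]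
    {M : I → Type*} [∀ i, (ordLanguage σ₁).Structure (M i)] (x y : SemidirectUnion I M) : Prop :=
  ordLt σ₂ x.1 y.1 ∨ ∃ (i : I) (a b : M i), x = ⟨i, a⟩ ∧ y = ⟨i, b⟩ ∧ ordLt σ₁ a b

theorem lt_iff_of_fst_ne {x y : SemidirectUnion I M} (h : x.1 ≠ y.1) :
    lt σ₁ σ₂ x y ↔ ordLt σ₂ x.1 y.1 := by
  refine ⟨?_, Or.inl⟩
  rintro (h' | ⟨i, a, b, rfl, rfl, -⟩)
  · exact h'
  · exact absurd rfl h

theorem lt_mk_mk_iff {i : I} {a b : M i} :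
    lt σ₁ σ₂ (⟨i, a⟩ : SemidirectUnion I M) ⟨i, b⟩ ↔ ordLt σ₂ i i ∨ ordLt σ₁ a b := by
  refine or_congr_right ⟨?_, fun h => ⟨i, a, b, rfl, rfl, h⟩⟩
  rintro ⟨_, _, _, ⟨⟩, ⟨⟩, h⟩
  exact h

theorem lt_map (h : I' ↪[ordLanguage σ₂] I) (d : ∀ i, M' i ↪[ordLanguage σ₁] M (h i))
    (x y : SemidirectUnion I' M') :
    lt σ₁ σ₂ (⟨h x.1, d _ x.2⟩ : SemidirectUnion I M) ⟨h y.1, d _ y.2⟩ ↔ lt σ₁ σ₂ x y := by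
  by_cases hxy : x.1 = y.1
  · obtain ⟨i, a⟩ := x
    obtain ⟨b, rfl⟩ := exists_eq_mk hxy.symm
    rw [lt_mk_mk_iff, lt_mk_mk_iff, ordLt_map, ordLt_map]
  · exact (lt_iff_of_fst_ne (h.injective.ne hxy)).trans
      ((ordLt_map h _ _).trans (lt_iff_of_fst_ne hxy).symm)

/-- The embedding of semi-direct products induced by an embedding of the bases and embeddings of
the fibers. -/
def map [Nonempty I'] (hM : NullaryAgree σ₁ M) (h : I' ↪[ordLanguage σ₂] I)
    (d : ∀ i, M' i ↪[ordLanguage σ₁] M (h i)) :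
    SemidirectUnion I' M' ↪[semidirectLanguage σ₁ σ₂] SemidirectUnion I M where
  toFun x := ⟨h x.1, d x.1 x.2⟩
  inj' := by
    rintro ⟨i, a⟩ ⟨j, b⟩ hab
    obtain rfl : i = j := h.injective (congrArg Sigma.fst hab)
    exact congrArg (Sigma.mk i) ((d i).injective (eq_of_heq (Sigma.mk.inj hab).2))
  map_fun' := fun g => isEmptyElim g
  map_rel' := fun {n} r => match n, r with
    | _, SemidirectRel.lt => fun x => lt_map h d (x 0) (x 1)
    | _, SemidirectRel.E => fun x => h.injective.eq_iff
    | _, SemidirectRel.fiber R => fiberRel_map hM h.injective d R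
    | _, SemidirectRel.base R => fun x => ordRel_map h R fun j => (x j).1

section Embedding

variable (f : SemidirectUnion I' M' ↪[semidirectLanguage σ₁ σ₂] SemidirectUnion I M)

theorem fst_map_eq_iff (x y : SemidirectUnion I' M') : (f x).1 = (f y).1 ↔ x.1 = y.1 :=
  f.map_rel (SemidirectRel.E : SemidirectRel σ₁ σ₂ 2) ![x, y]

theorem lt_map_iff (x y : SemidirectUnion I' M') :
    lt σ₁ σ₂ (f x) (f y) ↔ lt σ₁ σ₂ x y :=
  f.map_rel (SemidirectRel.lt : SemidirectRel σ₁ σ₂ 2) ![x, y]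

theorem fiberRel_map_iff {n : ℕ} (R : σ₁ n) (x : Fin n → SemidirectUnion I' M') :
    fiberRel R (fun j => f (x j)) ↔ fiberRel R x :=
  f.map_rel (SemidirectRel.fiber R : SemidirectRel σ₁ σ₂ n) x

theorem baseRel_map_iff {n : ℕ} (R : σ₂ n) (x : Fin n → SemidirectUnion I' M') :
    ordRel R (fun j => (f (x j)).1) ↔ ordRel R fun j => (x j).1 :=
  f.map_rel (SemidirectRel.base R : SemidirectRel σ₁ σ₂ n) x

variable {f} [∀ i, Nonempty (M' i)]

theorem exists_base_embedding (hI : IsOrderedStructure σ₂ I) (hI' : IsOrderedStructure σ₂ I') :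
    ∃ h : I' ↪[ordLanguage σ₂] I, ∀ x, (f x).1 = h x.1 := by
  let s (i : I') : SemidirectUnion I' M' := ⟨i, Classical.arbitrary (M' i)⟩
  have h_inj : Function.Injective fun i => (f (s i)).1 := fun i j =>
    (fst_map_eq_iff f (s i) (s j)).1
  refine ⟨ordEmbedding (fun i => (f (s i)).1) h_inj (fun i j => ?_) fun R t =>
    baseRel_map_iff f R fun j => s (t j), fun x => (fst_map_eq_iff f x (s x.1)).2 rfl⟩
  by_cases hij : i = j
  · subst hij
    exact iff_of_false (hI.not_ordLt_self _) (hI'.not_ordLt_self _)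
  · exact (lt_iff_of_fst_ne (h_inj.ne hij)).symm.trans
      ((lt_map_iff f (s i) (s j)).trans (lt_iff_of_fst_ne hij))

theorem exists_eq_map [Nonempty I'] (hI : IsOrderedStructure σ₂ I)
    (hI' : IsOrderedStructure σ₂ I') (hM : NullaryAgree σ₁ M) (hM' : NullaryAgree σ₁ M') :
    ∃ (h : I' ↪[ordLanguage σ₂] I) (d : ∀ i, M' i ↪[ordLanguage σ₁] M (h i)),
      f = map hM h d := by
  obtain ⟨h, hf⟩ := exists_base_embedding (f := f) hI hI'
  have hf' (i : I') (a : M' i) : ∃ b : M (h i), f ⟨i, a⟩ = ⟨h i, b⟩ := exists_eq_mk (hf ⟨i, a⟩)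
  choose d hd using hf'
  have d_inj (i : I') : Function.Injective (d i) := fun a b hab =>
    sigma_mk_injective (f.injective (by rw [hd i a, hd i b, hab]))
  have d_lt (i : I') (a b : M' i) : ordLt σ₁ (d i a) (d i b) ↔ ordLt σ₁ a b := by
    have key := lt_map_iff f ⟨i, a⟩ ⟨i, b⟩
    rwa [hd, hd, lt_mk_mk_iff, lt_mk_mk_iff, or_iff_right (hI.not_ordLt_self _),
      or_iff_right (hI'.not_ordLt_self _)] at key
  have d_rel (i : I') {n : ℕ} (R : σ₁ n) (a : Fin n → M' i) :
      ordRel R (fun j => d i (a j)) ↔ ordRel R a := by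
    have key := fiberRel_map_iff f R fun j => ⟨i, a j⟩
    simp only [hd] at key
    rwa [fiberRel_mk_iff hM, fiberRel_mk_iff hM'] at key
  exact ⟨h, fun i => ordEmbedding (d i) (d_inj i) (d_lt i) (d_rel i),
    Embedding.ext fun x => hd x.1 x.2⟩

end Embedding

end SemidirectUnion

end Semidirect

section Age

open FirstOrder FirstOrder.Language CategoryTheory

section

variable {L : FirstOrder.Language.{u₁, v}}

theorem nonempty_equiv_of_range_eq {A B C : Type*} [L.Structure A] [L.Structure B]
    [L.Structure C] {f : A ↪[L] C} {g : B ↪[L] C} (h : Set.range f = Set.range g) :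
    Nonempty (A ≃[L] B) := by
  have h' : f.toHom.range = g.toHom.range := SetLike.coe_injective h
  exact ⟨g.equivRange.symm.comp (h' ▸ f.equivRange : A ≃[L] g.toHom.range)⟩

/-- An isomorphism of structures, as an isomorphism in a category of embeddings. -/
def isoOfEquiv {K : Set (Bundled.{w} L.Structure)} {X Y : K} (e : X.1 ≃[L] Y.1) : X ≅ Y where
  hom := e.toEmbedding
  inv := e.symm.toEmbedding
  hom_inv_id := Embedding.ext e.symm_apply_apply
  inv_hom_id := Embedding.ext e.apply_symm_apply

variable {M : Type w} [L.Structure M]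

theorem closure_mem_age {s : Set M} (hs : s.Finite) :
    (⟨Substructure.closure L s, inferInstance⟩ : Bundled L.Structure) ∈ L.age M :=
  age.fg_substructure (Substructure.fg_closure hs)

variable [L.IsRelational]

theorem finite_of_mem_age {N : Bundled.{w} L.Structure} (hN : N ∈ L.age M) : Finite N :=
  Structure.fg_iff_finite.1 hN.1

theorem exists_joint_embedding_of_mem_age {P : Type*} [Finite P]
    {A : P → Bundled.{w} L.Structure} (hA : ∀ p, A p ∈ L.age M) :
    ∃ D ∈ L.age M, ∀ p, Nonempty (A p ↪[L] D) := by
  have (p : P) : Finite (A p) := finite_of_mem_age (hA p)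
  have f (p : P) : A p ↪[L] M := (hA p).2.some
  refine ⟨_, closure_mem_age (Set.finite_iUnion fun p => Set.finite_range (f p)), fun p => ⟨?_⟩⟩
  exact (f p).codRestrict _ fun x => Substructure.subset_closure (Set.mem_iUnion.2 ⟨p, x, rfl⟩)

end

section

variable {σ : ℕ → Type u₁} {I : Type*} {M : I → Type w} [∀ i, (ordLanguage σ).Structure (M i)]

theorem ordRel_iff_of_embedding {M N : Type*} [(ordLanguage σ).Structure M]
    [(ordLanguage σ).Structure N] (f : M ↪[ordLanguage σ] N) (R : σ 0) (x : Fin 0 → M)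
    (y : Fin 0 → N) : ordRel R x ↔ ordRel R y := by
  rw [← ordRel_map f, Subsingleton.elim (fun j => f (x j)) y]

theorem nullaryAgree_of_mem_age {N : Type w} [(ordLanguage σ).Structure N]
    {A : I → Bundled.{w} (ordLanguage σ).Structure} (hA : ∀ i, A i ∈ (ordLanguage σ).age N) :
    NullaryAgree σ fun i => A i := fun R i j x y =>
  (ordRel_iff_of_embedding (hA i).2.some R x Fin.elim0).trans
    (ordRel_iff_of_embedding (hA j).2.some R y Fin.elim0).symm

theorem nullaryAgree_of_age_eq {K : Set (Bundled.{w} (ordLanguage σ).Structure)}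
    (hK : ∀ i, (ordLanguage σ).age (M i) = K) : NullaryAgree σ M := by
  intro R i j x y
  have h_mem := closure_mem_age (L := ordLanguage σ) (M := M i) Set.finite_empty
  obtain ⟨f⟩ := h_mem.2
  rw [hK i, ← hK j] at h_mem
  obtain ⟨g⟩ := h_mem.2
  exact (ordRel_iff_of_embedding f R Fin.elim0 x).symm.trans
    (ordRel_iff_of_embedding g R Fin.elim0 y)

end

variable {σ₁ : ℕ → Type u₁} {σ₂ : ℕ → Type u₂}
  {I : Type v} [(ordLanguage σ₂).Structure I] {M : I → Type w}
  [∀ i, (ordLanguage σ₁).Structure (M i)] {K : Set (Bundled.{w} (ordLanguage σ₁).Structure)}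

theorem semidirectUnion_mem_age (hK : ∀ i, (ordLanguage σ₁).age (M i) = K)
    (C₀ : (ordLanguage σ₂).age I) [Nonempty C₀.1] (C : C₀.1 → K) :
    (⟨SemidirectUnion C₀.1 fun i => (C i).1, inferInstance⟩ :
      Bundled (semidirectLanguage σ₁ σ₂).Structure) ∈
        (semidirectLanguage σ₁ σ₂).age (SemidirectUnion I M) := by
  obtain ⟨h⟩ := C₀.2.2
  have hC (i : C₀.1) : (C i).1 ∈ (ordLanguage σ₁).age (M (h i)) := (hK (h i)).symm ▸ (C i).2
  have := finite_of_mem_age C₀.2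
  have (i : C₀.1) : Finite (C i).1 := finite_of_mem_age (hC i)
  have : Finite (SemidirectUnion C₀.1 fun i => (C i).1) :=
    inferInstanceAs (Finite (Σ i, (C i).1))
  exact ⟨Structure.fg_iff_finite.2 this,
    ⟨SemidirectUnion.map (nullaryAgree_of_age_eq hK) h fun i => (hC i).2.some⟩⟩

/-- The semi-direct product of members of `K` along a nonempty member of the age of `I`, as a
member of the age of the semi-direct product of the `M i`. -/
def ageUnion (hK : ∀ i, (ordLanguage σ₁).age (M i) = K) (C₀ : (ordLanguage σ₂).age I)
    [Nonempty C₀.1] (C : C₀.1 → K) :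
    (semidirectLanguage σ₁ σ₂).age (SemidirectUnion I M) :=
  ⟨⟨SemidirectUnion C₀.1 fun i => (C i).1, inferInstance⟩, semidirectUnion_mem_age hK C₀ C⟩

theorem exists_substructures_equiv (hM : NullaryAgree σ₁ M) {A : Type*} [Finite A] [Nonempty A]
    [(semidirectLanguage σ₁ σ₂).Structure A]
    (f : A ↪[semidirectLanguage σ₁ σ₂] SemidirectUnion I M) :
    ∃ (S : (ordLanguage σ₂).Substructure I) (T : ∀ i, (ordLanguage σ₁).Substructure (M i)),
      S.FG ∧ (∀ i, (T i).FG) ∧ Nonempty S ∧ (∀ i : S, Nonempty (T i)) ∧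
        Nonempty (A ≃[semidirectLanguage σ₁ σ₂] SemidirectUnion S fun i => T i) := by
  let S : (ordLanguage σ₂).Substructure I := .closure _ (Set.range fun x => (f x).1)
  let T (i : I) : (ordLanguage σ₁).Substructure (M i) :=
    .closure _ {m | (⟨i, m⟩ : SemidirectUnion I M) ∈ Set.range f}
  have mem_S {i : I} : i ∈ S ↔ ∃ x, (f x).1 = i := Substructure.mem_closure_iff_of_isRelational ..
  have mem_T {i : I} {m : M i} : m ∈ T i ↔ ∃ x, f x = (⟨i, m⟩ : SemidirectUnion I M) :=
    Substructure.mem_closure_iff_of_isRelational ..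
  have S_fg : S.FG := Substructure.fg_closure (Set.finite_range _)
  have T_fg (i : I) : (T i).FG :=
    Substructure.fg_closure ((Set.finite_range f).preimage sigma_mk_injective.injOn)
  have S_nonempty : Nonempty S := ⟨⟨_, mem_S.2 ⟨Classical.arbitrary A, rfl⟩⟩⟩
  have T_nonempty : ∀ i : S, Nonempty (T i) := by
    rintro ⟨i, hi⟩
    obtain ⟨x, rfl⟩ := mem_S.1 hi
    exact ⟨⟨(f x).2, mem_T.2 ⟨x, rfl⟩⟩⟩
  let g : SemidirectUnion S (fun i => T i) ↪[semidirectLanguage σ₁ σ₂] SemidirectUnion I M :=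
    SemidirectUnion.map hM S.subtype fun i => (T i).subtype
  have range_eq : Set.range f = Set.range g := by
    apply Set.Subset.antisymm
    · rintro _ ⟨x, rfl⟩
      exact ⟨⟨⟨_, mem_S.2 ⟨x, rfl⟩⟩, ⟨(f x).2, mem_T.2 ⟨x, rfl⟩⟩⟩, rfl⟩
    · rintro _ ⟨⟨i, m, hm⟩, rfl⟩
      exact mem_T.1 hm
  exact ⟨S, T, S_fg, T_fg, S_nonempty, T_nonempty, nonempty_equiv_of_range_eq range_eq⟩

theorem exists_iso_ageUnion (hK : ∀ i, (ordLanguage σ₁).age (M i) = K)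
    (X : (semidirectLanguage σ₁ σ₂).age (SemidirectUnion I M)) [Nonempty X.1] :
    ∃ (A₀ : (ordLanguage σ₂).age I) (_ : Nonempty A₀.1) (A : A₀.1 → K),
      (∀ i, Nonempty (A i).1) ∧ Nonempty (X ≅ ageUnion hK A₀ A) := by
  have := finite_of_mem_age X.2
  obtain ⟨f⟩ := X.2.2
  obtain ⟨S, T, S_fg, T_fg, S_nonempty, T_nonempty, ⟨e⟩⟩ :=
    exists_substructures_equiv (nullaryAgree_of_age_eq hK) f
  exact ⟨⟨⟨S, inferInstance⟩, age.fg_substructure S_fg⟩, S_nonempty,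
    fun i : S => ⟨⟨T i, inferInstance⟩, hK i ▸ age.fg_substructure (T_fg i)⟩,
    T_nonempty, ⟨isoOfEquiv e⟩⟩

theorem exists_ramseyArrow_ageUnion (hI : IsOrderedStructure σ₂ I)
    (hK : ∀ i, (ordLanguage σ₁).age (M i) = K) (hIRP : HasRP (ordLanguage σ₂) I)
    (hKRP : RamseyProperty K) {A₀ B₀ : (ordLanguage σ₂).age I} [Nonempty A₀.1] [Nonempty B₀.1]
    (A : A₀.1 → K) (B : B₀.1 → K) [∀ i, Nonempty (A i).1] (k : ℕ) :
    ∃ D, RamseyArrow (ageUnion hK A₀ A) (ageUnion hK B₀ B) D (Fin (k + 1)) := by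
  obtain ⟨i₀⟩ : Nonempty I := Nonempty.map A₀.2.2.some inferInstance
  have mem_age (X : K) : X.1 ∈ (ordLanguage σ₁).age (M i₀) := (hK i₀).symm ▸ X.2
  have (X : (ordLanguage σ₂).age I) : Finite X.1 := finite_of_mem_age X.2
  have (X : K) : Finite X.1 := finite_of_mem_age (mem_age X)
  have I_ramsey : IsRamsey ((ordLanguage σ₂).age I) := ramseyProperty_iff_isRamsey.1 hIRP
  have K_ramsey : IsRamsey K := ramseyProperty_iff_isRamsey.1 hKRP
  have (X Y : K) : Finite (X ⟶ Y) := inferInstanceAs (Finite (X.1 ↪[ordLanguage σ₁] Y.1))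
  have ordered (X : (ordLanguage σ₂).age I) : IsOrderedStructure σ₂ X.1 :=
    hI.of_embedding X.2.2.some
  have nullary {ι : Type v} (C : ι → K) : NullaryAgree σ₁ fun i => (C i).1 :=
    nullaryAgree_of_mem_age fun i => mem_age (C i)
  have : Subsingleton (A₀ ⟶ A₀) := (ordered A₀).subsingleton_embedding
  obtain ⟨D, hD, δ⟩ := exists_joint_embedding_of_mem_age fun p => mem_age (Sum.elim A B p)
  obtain ⟨C₀, C, hC⟩ := K_ramsey.exists_forall_embedding_arrow I_ramsey (D := ⟨D, hK i₀ ▸ hD⟩)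
    (fun i => (δ (.inl i)).some) (fun j => (δ (.inr j)).some) k
  have : Nonempty C₀.1 := by
    obtain ⟨g₀, -⟩ := hC (fun _ _ => 0) fun _ _ _ => rfl
    exact Nonempty.map g₀ inferInstance
  refine ⟨ageUnion hK C₀ C, fun c hc => ?_⟩
  obtain ⟨g₀, g, hg⟩ := hC (fun h d => c (SemidirectUnion.map (nullary C) h d)) fun h e f =>
    hc (SemidirectUnion.map (nullary A) (Embedding.refl _ _) e)
      (SemidirectUnion.map (nullary C) h f)
  refine ⟨SemidirectUnion.map (nullary C) g₀ g, fun u u' => ?_⟩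
  obtain ⟨h, d, rfl⟩ := SemidirectUnion.exists_eq_map (f := u) (ordered B₀) (ordered A₀)
    (nullary B) (nullary A)
  obtain ⟨h', d', rfl⟩ := SemidirectUnion.exists_eq_map (f := u') (ordered B₀) (ordered A₀)
    (nullary B) (nullary A)
  exact hg h h' d d'

end Age

open CategoryTheory FirstOrder.Language in
theorem theorem5_general {σ₁ : ℕ → Type*} {σ₂ : ℕ → Type*}
    (I : Type*) [(ordLanguage σ₂).Structure I] (hI : IsOrderedStructure σ₂ I)
    (M : I → Type*) [∀ i, (ordLanguage σ₁).Structure (M i)]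
    (K : Set (Bundled (ordLanguage σ₁).Structure))
    (hK : ∀ i, (ordLanguage σ₁).age (M i) = K)
    (hIRP : HasRP (ordLanguage σ₂) I) (hKRP : RamseyProperty K) :
    HasRP (semidirectLanguage σ₁ σ₂) (SemidirectUnion I M) := by
  have (X : (semidirectLanguage σ₁ σ₂).age (SemidirectUnion I M)) : Finite X.1 :=
    finite_of_mem_age X.2
  refine ramseyProperty_iff_isRamsey.2 fun X Y k => ?_
  obtain hX | hX := isEmpty_or_nonempty X.1
  · have : Subsingleton (X ⟶ Y) := ⟨fun f g => Embedding.ext hX.elim⟩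
    exact ⟨Y, .of_subsingleton X Y _⟩
  obtain hY | hY := isEmpty_or_nonempty Y.1
  · have : IsEmpty (X ⟶ Y) := ⟨fun f : X.1 ↪[_] Y.1 => hX.elim fun x => hY.false (f x)⟩
    exact ⟨Y, .of_subsingleton X Y _⟩
  obtain ⟨A₀, _, A, _, ⟨a⟩⟩ := exists_iso_ageUnion hK X
  obtain ⟨B₀, _, B, -, ⟨b⟩⟩ := exists_iso_ageUnion hK Y
  obtain ⟨D, hD⟩ := exists_ramseyArrow_ageUnion hI hK hIRP hKRP A B k
  exact ⟨D, hD.of_iso a b⟩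

theorem theorem5 {σ₁ : ℕ → Type*} {σ₂ : ℕ → Type*}
    (I : Type*) [Countable I] [(ordLanguage σ₂).Structure I]
    (hI : IsOrderedStructure σ₂ I)
    (M : I → Type*) [∀ i, Countable (M i)] [∀ i, (ordLanguage σ₁).Structure (M i)]
    (hM : ∀ i, IsOrderedStructure σ₁ (M i))
    (K : Set (CategoryTheory.Bundled (ordLanguage σ₁).Structure))
    (hK : ∀ i, (ordLanguage σ₁).age (M i) = K)
    (hIRP : HasRP (ordLanguage σ₂) I) (hKRP : RamseyProperty K) :
    HasRP (semidirectLanguage σ₁ σ₂) (SemidirectUnion I M) :=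
  theorem5_general I hI M K hK hIRP hKRP
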